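/- Let \((X,d)\) be a proper metric space, that is, a metric space whose closed bounded subsets are compact. Let \(H_1\) and \(H_2\) be separable Hilbert spaces over the same field \(\mathbb{K}\in\{\mathbb{R},\mathbb{C}\}\), and let \(C_0(X)\) be the algebra of continuous functions \(X\to\mathbb{K}\) that vanish at infinity. For \(i=1,2\), let \(\varrho_i\colon C_0(X)\to\mathbb{B}(H_i)\) be a nondegenerate \(^*\)-representation (the linear span of \(\varrho_i(C_0(X))H_i\) is dense in \(H_i\)) that is ample, that is, \(\varrho_i(f)\) is compact only for \(f=0\). For a nondegenerate \(^*\)-representation \(\varrho\colon C_0(X)\to\mathbb{B}(H)\), call \(T\in\mathbb{B}(H)\) locally compact if \(\varrho(f)T\) and \(T\varrho(f)\) are compact for all \(f\in C_0(X)\). The support of \(T\) is the set of those \((x,y)\in X\times X\) for which there are no open neighbourhoods \(U\) of \(x\) and \(V\) of \(y\) with \(\varrho(f)T\varrho(g)=0\) for all \(f\in C_0(U)\), \(g\in C_0(V)\). Call \(T\) controlled if there is \(R>0\) with \(d(x,y)\le R\) for all \((x,y)\) in the support of \(T\). The locally compact, controlled operators form a \(^*\)-algebra; its norm closure in \(\mathbb{B}(H)\)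 is the Roe \(C^*\)-algebra \(C^*_{\mathrm{Roe}}(X,\varrho)\). Then \(C^*_{\mathrm{Roe}}(X,\varrho_1)\cong C^*_{\mathrm{Roe}}(X,\varrho_2)\) as \(^*\)-algebras over \(\mathbb{K}\). Even more, there is a unitary operator \(U\colon H_1\to H_2\) with \[ U\,C^*_{\mathrm{Roe}}(X,\varrho_1)\,U^* = C^*_{\mathrm{Roe}}(X,\varrho_2). \] -/

import Mathlib

open scoped ZeroAtInfty

namespace RoeAlgebra

section Definitions

variable {𝕜 : Type*} [RCLike 𝕜] {X : Type*} [MetricSpace X]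
  {H : Type*} [NormedAddCommGroup H] [InnerProductSpace 𝕜 H] [CompleteSpace H]

/-- A representation `ρ : C₀(X) → 𝔹(H)` (a `*`-homomorphism) is nondegenerate if the linear span
of the vectors `ρ(f) v` is dense in `H`. -/
def IsNondegenerate (ρ : C₀(X, 𝕜) →⋆ₙₐ[𝕜] (H →L[𝕜] H)) : Prop :=
  (Submodule.span 𝕜 {w : H | ∃ (f : C₀(X, 𝕜)) (v : H), ρ f v = w}).topologicalClosure = ⊤

/-- A representation is ample if `ρ(f)` is compact only for `f = 0`. -/
def IsAmple (ρ : C₀(X, 𝕜) →⋆ₙₐ[𝕜] (H →L[𝕜] H)) : Prop :=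
  ∀ f : C₀(X, 𝕜), IsCompactOperator (ρ f) → f = 0

/-- `T` is locally compact if `ρ(f) T` and `T ρ(f)` are compact for all `f ∈ C₀(X)`. -/
def IsLocallyCompact (ρ : C₀(X, 𝕜) →⋆ₙₐ[𝕜] (H →L[𝕜] H)) (T : H →L[𝕜] H) : Prop :=
  ∀ f : C₀(X, 𝕜), IsCompactOperator (ρ f * T) ∧ IsCompactOperator (T * ρ f)

/-- `f ∈ C₀(X)` vanishes outside `U`; for open `U` this says `f ∈ C₀(U)`. -/
def VanishesOff (f : C₀(X, 𝕜)) (U : Set X) : Prop :=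
  ∀ x, x ∉ U → f x = 0

/-- The support of `T`: its complement consists of the points `(x, y)` that have open
neighbourhoods `U` and `V` with `ρ(f) T ρ(g) = 0` for all `f ∈ C₀(U)` and `g ∈ C₀(V)`. -/
def supp (ρ : C₀(X, 𝕜) →⋆ₙₐ[𝕜] (H →L[𝕜] H)) (T : H →L[𝕜] H) : Set (X × X) :=
  {p | ∃ U V : Set X, IsOpen U ∧ p.1 ∈ U ∧ IsOpen V ∧ p.2 ∈ V ∧
    ∀ f g : C₀(X, 𝕜), VanishesOff f U → VanishesOff g V → ρ f * T * ρ g = 0}ᶜ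

/-- `T` is controlled (has finite propagation) if there is `R > 0` with `d(x, y) ≤ R` for all
`(x, y)` in the support of `T`. -/
def IsControlled (ρ : C₀(X, 𝕜) →⋆ₙₐ[𝕜] (H →L[𝕜] H)) (T : H →L[𝕜] H) : Prop :=
  ∃ R : ℝ, 0 < R ∧ ∀ p ∈ supp ρ T, dist p.1 p.2 ≤ R

end Definitions

/-! Facts that show that the locally compact, controlled operators form a `*`-algebra. -/

section Compact

variable {𝕜 : Type*} [RCLike 𝕜]
  {H : Type*} [NormedAddCommGroup H] [InnerProductSpace 𝕜 H] [CompleteSpace H]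

theorem isCompactOperator_star {T : H →L[𝕜] H} (hT : IsCompactOperator T) :
    IsCompactOperator (star T : H →L[𝕜] H) := by
  have h1 : IsCompactOperator (T * star T) := hT.comp_clm (star T : H →L[𝕜] H)
  have htb : TotallyBounded ((T * star T : H →L[𝕜] H) '' Metric.closedBall 0 1) :=
    (IsCompactOperator.isCompact_closure_image_closedBall (𝕜₁ := 𝕜)
      (f := ((T * star T : H →L[𝕜] H) : H →ₗ[𝕜] H)) h1 1).totallyBounded.subset subset_closure
  refine (isCompactOperator_iff_isCompact_closure_image_closedBall
    ((star T : H →L[𝕜] H) : H →ₗ[𝕜] H) one_pos).2 ?_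
  refine TotallyBounded.isCompact_of_isClosed (TotallyBounded.closure ?_) isClosed_closure
  rw [Metric.totallyBounded_iff]
  intro ε hε
  obtain ⟨t, hts, htf, ht⟩ := totallyBounded_iff_subset.1 htb _
    (Metric.dist_mem_uniformity (show 0 < ε ^ 2 / 2 by positivity))
  have hts' : ∀ y ∈ t, ∃ u ∈ Metric.closedBall (0 : H) 1,
      (T * star T : H →L[𝕜] H) u = y := fun y hy => hts hy
  choose! u hu hut using hts'
  refine ⟨(fun y => (star T : H →L[𝕜] H) (u y)) '' t, htf.image _, ?_⟩
  rintro _ ⟨v, hv, rfl⟩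
  obtain ⟨y, hy, hvy⟩ := Set.mem_iUnion₂.1 (ht ⟨v, hv, rfl⟩)
  refine Set.mem_iUnion₂.2 ⟨_, ⟨y, hy, rfl⟩, ?_⟩
  have hvy' : dist ((T * star T : H →L[𝕜] H) v) y < ε ^ 2 / 2 := hvy
  rw [← hut y hy, dist_eq_norm, ← map_sub] at hvy'
  have hw : ‖v - u y‖ ≤ 2 := by
    have h1 : ‖v‖ ≤ 1 := by simpa using hv
    have h2 : ‖u y‖ ≤ 1 := by simpa using hu y hy
    linarith [norm_sub_le v (u y)]
  have key : ‖(star T : H →L[𝕜] H) (v - u y)‖ ^ 2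
      ≤ ‖(T * star T : H →L[𝕜] H) (v - u y)‖ * ‖v - u y‖ := by
    rw [← inner_self_eq_norm_sq (𝕜 := 𝕜), ContinuousLinearMap.star_eq_adjoint,
      ContinuousLinearMap.adjoint_inner_right]
    exact re_inner_le_norm _ _
  change dist ((star T : H →L[𝕜] H) v) ((star T : H →L[𝕜] H) (u y)) < ε
  rw [dist_eq_norm, ← map_sub]
  have h0 := norm_nonneg ((T * star T : H →L[𝕜] H) (v - u y))
  refine lt_of_pow_lt_pow_left₀ 2 hε.le ?_
  nlinarith

end Compact

section Local

variable {𝕜 : Type*} [RCLike 𝕜] {X : Type*} [MetricSpace X]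
  {H : Type*} [NormedAddCommGroup H] [InnerProductSpace 𝕜 H] [CompleteSpace H]

/-- A compactly supported real function as an element of `C₀(X)`. -/
noncomputable def ofCompactSupport (𝕜 : Type*) [RCLike 𝕜] (φ : C(X, ℝ))
    (hφ : HasCompactSupport φ) : C₀(X, 𝕜) where
  toFun x := (φ x : 𝕜)
  continuous_toFun := by fun_prop
  zero_at_infty' := by
    have h : HasCompactSupport (fun x => ((φ x : ℝ) : 𝕜)) :=
      hφ.comp_left (g := fun r : ℝ => (r : 𝕜)) (by simp)
    exact h.is_zero_at_infty

theorem ofCompactSupport_apply (φ : C(X, ℝ)) (hφ : HasCompactSupport φ) (x : X) :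
    ofCompactSupport 𝕜 φ hφ x = (φ x : 𝕜) := rfl

theorem mem_of_locally_mem [ProperSpace X] (M : Submodule 𝕜 C₀(X, 𝕜)) {K : Set X}
    (hK : IsCompact K)
    (h : ∀ z ∈ K, ∃ V : Set X, IsOpen V ∧ z ∈ V ∧ ∀ f : C₀(X, 𝕜), VanishesOff f V → f ∈ M)
    (f : C₀(X, 𝕜)) (hf : VanishesOff f K) : f ∈ M := by
  choose! V hVo hzV hV using h
  obtain ⟨t, htK, ht⟩ := hK.elim_nhds_subcover V (fun z hz => (hVo z hz).mem_nhds (hzV z hz))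
  have hcov : K ⊆ ⋃ i : Fin t.card, V (t.equivFin.symm i) := by
    intro z hz
    obtain ⟨y, hy, hzy⟩ := Set.mem_iUnion₂.1 (ht hz)
    exact Set.mem_iUnion.2 ⟨t.equivFin ⟨y, hy⟩, by simpa using hzy⟩
  obtain ⟨φ, hφs, hφ1, -, hφc⟩ := exists_continuous_sum_one_of_isOpen_isCompact
    (fun i => hVo _ (htK _ (t.equivFin.symm i).2)) hK hcov
  have hsum : f = ∑ i, ofCompactSupport 𝕜 (φ i) (hφc i) * f := by
    ext x
    rw [← Finset.sum_mul, ZeroAtInftyContinuousMap.mul_apply]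
    by_cases hx : x ∈ K
    · have h1 := hφ1 hx
      have h2 : (∑ i, ofCompactSupport 𝕜 (φ i) (hφc i)) x = ∑ i, ((φ i x : ℝ) : 𝕜) :=
        map_sum (⟨⟨fun g => g x, rfl⟩, fun _ _ => rfl⟩ : C₀(X, 𝕜) →+ 𝕜)
          (fun i => ofCompactSupport 𝕜 (φ i) (hφc i)) Finset.univ
      rw [h2, ← RCLike.ofReal_sum]
      simp only [Finset.sum_apply, Pi.one_apply] at h1
      rw [h1]; simp
    · simp [hf x hx]
  rw [hsum]
  refine M.sum_mem fun i _ => hV _ (htK _ (t.equivFin.symm i).2) _ fun x hx => ?_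
  have : φ i x = 0 := image_eq_zero_of_notMem_tsupport fun h => hx (hφs i h)
  simp [ofCompactSupport_apply, this]

theorem mem_of_isClosed [ProperSpace X] (M : Submodule 𝕜 C₀(X, 𝕜))
    (hM : IsClosed (M : Set C₀(X, 𝕜))) {F : Set X} (hF : IsClosed F)
    (h : ∀ K ⊆ F, IsCompact K → ∀ f : C₀(X, 𝕜), VanishesOff f K → f ∈ M)
    (f : C₀(X, 𝕜)) (hf : VanishesOff f F) : f ∈ M := by
  refine hM.closure_subset (Metric.mem_closure_iff.2 fun ε hε => ?_)
  have hev : ∀ᶠ x in Filter.cocompact X, ‖f x‖ < ε / 2 := by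
    have := (zero_at_infty f).norm
    rw [norm_zero] at this
    exact this.eventually (gt_mem_nhds (by positivity))
  obtain ⟨L, hL, hLs⟩ := Filter.mem_cocompact.1 hev
  obtain ⟨φ, hφ1, -, hφc, hφI⟩ := exists_continuous_one_zero_of_isCompact hL
    (isClosed_empty (X := X)) (Set.disjoint_empty _)
  refine ⟨ofCompactSupport 𝕜 φ hφc * f, h (tsupport φ ∩ F) Set.inter_subset_right
    (hφc.isCompact.inter_right hF) _ fun x hx => ?_, ?_⟩
  · by_cases hxF : x ∈ F
    · have : φ x = 0 := image_eq_zero_of_notMem_tsupport fun h => hx ⟨h, hxF⟩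
      simp [ofCompactSupport_apply, this]
    · simp [hf x hxF]
  · rw [← ZeroAtInftyContinuousMap.dist_toBCF_eq_dist]
    refine lt_of_le_of_lt ((BoundedContinuousFunction.dist_le (by positivity)).2 fun x => ?_)
      (half_lt_self hε)
    change dist (f x) ((φ x : 𝕜) * f x) ≤ ε / 2
    have h1 : f x - (φ x : 𝕜) * f x = ((1 - φ x : ℝ) : 𝕜) * f x := by push_cast; ring
    rw [dist_eq_norm, h1, norm_mul, RCLike.norm_ofReal,
      abs_of_nonneg (sub_nonneg.2 (hφI x).2)]
    by_cases hx : x ∈ L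
    · rw [hφ1 hx]; simp; positivity
    · have h2 : ‖f x‖ < ε / 2 := hLs hx
      nlinarith [(hφI x).1, (hφI x).2, norm_nonneg (f x)]

/-- Representations of `C₀(X)` are contractive, over the real and over the complex numbers. -/
theorem norm_apply_le (ρ : C₀(X, 𝕜) →⋆ₙₐ[𝕜] (H →L[𝕜] H)) (f : C₀(X, 𝕜)) : ‖ρ f‖ ≤ ‖f‖ := by
  rcases eq_or_ne f 0 with rfl | hf0
  · simp
  have hpos : 0 < ‖f‖ := norm_pos_iff.2 hf0
  have hle (x : X) : ‖f x‖ ≤ ‖f‖ := f.toBCF.norm_coe_le_norm x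
  have hc : 0 < ‖f‖ ^ 2 := by positivity
  let γ : X → ℝ := fun x => 1 - √(1 - ‖f x‖ ^ 2 / ‖f‖ ^ 2)
  have hγ (x : X) : ‖f x‖ ^ 2 = ‖f‖ ^ 2 * (γ x + γ x - γ x * γ x) := by
    have h1 : 0 ≤ 1 - ‖f x‖ ^ 2 / ‖f‖ ^ 2 := by
      rw [sub_nonneg, div_le_one hc]
      exact pow_le_pow_left₀ (norm_nonneg _) (hle x) 2
    have h2 := Real.mul_self_sqrt h1
    have h3 : γ x + γ x - γ x * γ x = ‖f x‖ ^ 2 / ‖f‖ ^ 2 := by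
      simp only [γ]; linear_combination -h2
    rw [h3]; field_simp
  have hγc : Continuous γ := by fun_prop
  let g : C₀(X, 𝕜) :=
    { toFun := fun x => (γ x : 𝕜)
      continuous_toFun := by fun_prop
      zero_at_infty' := by
        have hF : Continuous fun z : 𝕜 => ((1 - √(1 - ‖z‖ ^ 2 / ‖f‖ ^ 2) : ℝ) : 𝕜) := by fun_prop
        have := (hF.tendsto 0).comp (zero_at_infty f)
        simpa [γ, Function.comp_def] using this }
  have hg (x : X) : g x = (γ x : 𝕜) := rfl
  have hgs : star g = g := by ext x; simp [hg]
  have hid : star f * f = ((‖f‖ ^ 2 : ℝ) : 𝕜) • (g + g - star g * g) := by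
    ext x
    simp only [ZeroAtInftyContinuousMap.mul_apply, ZeroAtInftyContinuousMap.star_apply,
      ZeroAtInftyContinuousMap.smul_apply, ZeroAtInftyContinuousMap.sub_apply,
      ZeroAtInftyContinuousMap.add_apply, hgs, hg, smul_eq_mul, RCLike.star_def, RCLike.conj_mul]
    exact_mod_cast hγ x
  have hsq (k : C₀(X, 𝕜)) (v : H) :
      RCLike.re (inner 𝕜 (ρ (star k * k) v) v) = ‖ρ k v‖ ^ 2 := by
    rw [map_mul, map_star, ContinuousLinearMap.star_eq_adjoint, mul_apply_eq_comp,
      ContinuousLinearMap.adjoint_inner_left, inner_self_eq_norm_sq]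
  refine ContinuousLinearMap.opNorm_le_bound _ (norm_nonneg _) fun v => ?_
  have h1 := hsq f v
  rw [hid, map_smul, map_sub, map_add, smul_apply,
    inner_smul_left, RCLike.conj_ofReal, RCLike.re_ofReal_mul, sub_apply,
    add_apply, inner_sub_left, inner_add_left, map_sub, map_add, hsq] at h1
  have h2 := norm_sub_sq (𝕜 := 𝕜) (ρ g v) v
  have h3 : 2 * RCLike.re (inner 𝕜 (ρ g v) v) - ‖ρ g v‖ ^ 2 ≤ ‖v‖ ^ 2 := by
    nlinarith [sq_nonneg ‖ρ g v - v‖]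
  refine (pow_le_pow_iff_left₀ (norm_nonneg _) (by positivity) two_ne_zero).1 ?_
  rw [mul_pow, ← h1]
  refine mul_le_mul_of_nonneg_left ?_ hc.le
  linarith

end Local

section Product

variable {𝕜 : Type*} [RCLike 𝕜] {X : Type*} [MetricSpace X]
  {H : Type*} [NormedAddCommGroup H] [InnerProductSpace 𝕜 H] [CompleteSpace H]

theorem continuous_rep (ρ : C₀(X, 𝕜) →⋆ₙₐ[𝕜] (H →L[𝕜] H)) : Continuous ρ :=
  AddMonoidHomClass.continuous_of_bound ρ 1 fun f => by simpa using norm_apply_le ρ f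

theorem mul_mul_eq_zero_of_isCompact [ProperSpace X] (ρ : C₀(X, 𝕜) →⋆ₙₐ[𝕜] (H →L[𝕜] H))
    (T : H →L[𝕜] H) {K L : Set X} (hK : IsCompact K) (hL : IsCompact L)
    (hKL : ∀ x ∈ K, ∀ y ∈ L, (x, y) ∉ supp ρ T) (f g : C₀(X, 𝕜))
    (hf : VanishesOff f K) (hg : VanishesOff g L) : ρ f * T * ρ g = 0 := by
  let M : Submodule 𝕜 C₀(X, 𝕜) :=
    { carrier := {f | ρ f * T * ρ g = 0}
      zero_mem' := by simp
      add_mem' := fun {a b} ha hb => by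
        simp only [Set.mem_ofPred_eq] at ha hb ⊢
        rw [map_add, add_mul, add_mul, ha, hb, add_zero]
      smul_mem' := fun c a ha => by
        simp only [Set.mem_ofPred_eq] at ha ⊢
        rw [map_smul, smul_mul_assoc, smul_mul_assoc, ha, smul_zero] }
  refine mem_of_locally_mem M hK (fun x hx => ?_) f hf
  let N : Submodule 𝕜 C₀(X, 𝕜) :=
    { carrier := {g | ∃ U : Set X, IsOpen U ∧ x ∈ U ∧
        ∀ f : C₀(X, 𝕜), VanishesOff f U → ρ f * T * ρ g = 0}
      zero_mem' := ⟨Set.univ, isOpen_univ, Set.mem_univ _, by simp⟩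
      add_mem' := by
        rintro a b ⟨U, hU, hxU, ha⟩ ⟨V, hV, hxV, hb⟩
        refine ⟨U ∩ V, hU.inter hV, ⟨hxU, hxV⟩, fun f hf => ?_⟩
        rw [map_add, mul_add, ha f fun z hz => hf z fun h => hz h.1,
          hb f fun z hz => hf z fun h => hz h.2, add_zero]
      smul_mem' := by
        rintro c a ⟨U, hU, hxU, ha⟩
        refine ⟨U, hU, hxU, fun f hf => ?_⟩
        rw [map_smul, mul_smul_comm, ha f hf, smul_zero] }
  refine mem_of_locally_mem N hL (fun y hy => ?_) g hg
  have := hKL x hx y hy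
  rw [supp, Set.notMem_compl_iff] at this
  obtain ⟨U, V, hU, hxU, hV, hyV, h⟩ := this
  exact ⟨V, hV, hyV, fun g hg => ⟨U, hU, hxU, fun f hf => h f g hf hg⟩⟩

theorem mul_mul_eq_zero [ProperSpace X] (ρ : C₀(X, 𝕜) →⋆ₙₐ[𝕜] (H →L[𝕜] H))
    (T : H →L[𝕜] H) {K F : Set X} (hK : IsCompact K) (hF : IsClosed F)
    (hKF : ∀ x ∈ K, ∀ y ∈ F, (x, y) ∉ supp ρ T) (f g : C₀(X, 𝕜))
    (hf : VanishesOff f K) (hg : VanishesOff g F) : ρ f * T * ρ g = 0 := by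
  let M : Submodule 𝕜 C₀(X, 𝕜) :=
    { carrier := {g | ρ f * T * ρ g = 0}
      zero_mem' := by simp
      add_mem' := fun {a b} ha hb => by
        simp only [Set.mem_ofPred_eq] at ha hb ⊢
        rw [map_add, mul_add, ha, hb, add_zero]
      smul_mem' := fun c a ha => by
        simp only [Set.mem_ofPred_eq] at ha ⊢
        rw [map_smul, mul_smul_comm, ha, smul_zero] }
  have hM : IsClosed (M : Set C₀(X, 𝕜)) :=
    isClosed_eq (continuous_const.mul (continuous_rep ρ)) continuous_const
  exact mem_of_isClosed M hM hF (fun L hLF hL g hg =>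
    mul_mul_eq_zero_of_isCompact ρ T hK hL (fun x hx y hy => hKF x hx y (hLF hy)) f g hf hg) g hg

theorem eq_of_forall_mul_eq {ρ : C₀(X, 𝕜) →⋆ₙₐ[𝕜] (H →L[𝕜] H)} (hρ : IsNondegenerate ρ)
    {S T : H →L[𝕜] H} (h : ∀ f, S * ρ f = T * ρ f) : S = T := by
  refine ContinuousLinearMap.ext_on
    (s := {w : H | ∃ (f : C₀(X, 𝕜)) (v : H), ρ f v = w}) ?_ ?_
  · exact Submodule.dense_iff_topologicalClosure_eq_top.2 hρ
  · rintro _ ⟨f, v, rfl⟩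
    exact DFunLike.congr_fun (h f) v

theorem IsControlled.mul [ProperSpace X] {ρ : C₀(X, 𝕜) →⋆ₙₐ[𝕜] (H →L[𝕜] H)}
    (hρ : IsNondegenerate ρ) {S T : H →L[𝕜] H} (hT : IsControlled ρ T) (hS : IsControlled ρ S) :
    IsControlled ρ (T * S) := by
  obtain ⟨R, hR, hT⟩ := hT
  obtain ⟨R', hR', hS⟩ := hS
  refine ⟨R + R', by positivity, fun ⟨x, y⟩ hp => ?_⟩
  by_contra! hd
  refine hp ?_
  obtain ⟨ε, hε, hd⟩ : ∃ ε : ℝ, 0 < ε ∧ R + R' + 5 * ε = dist x y :=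
    ⟨(dist x y - R - R') / 5, by simp only at hd; linarith, by ring⟩
  refine ⟨Metric.ball x ε, Metric.ball y ε, Metric.isOpen_ball, Metric.mem_ball_self hε,
    Metric.isOpen_ball, Metric.mem_ball_self hε, fun f g hf hg => ?_⟩
  obtain ⟨φ, hφ1, hφ0, hφc, -⟩ := exists_continuous_one_zero_of_isCompact
    (isCompact_closedBall x (R + 2 * ε)) (Metric.isOpen_ball (x := x) (ε := R + 3 * ε)).isClosed_compl
    (Set.disjoint_compl_right_iff_subset.2
      (Metric.closedBall_subset_ball (by linarith)))
  let χ := ofCompactSupport 𝕜 φ hφc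
  have h1 : ρ f * T = ρ f * T * ρ χ := by
    refine eq_of_forall_mul_eq hρ fun h => ?_
    rw [mul_assoc _ (ρ χ), ← map_mul, ← sub_eq_zero, ← mul_sub, ← map_sub]
    refine mul_mul_eq_zero ρ T (isCompact_closedBall x ε)
      (Metric.isOpen_ball (x := x) (ε := R + 2 * ε)).isClosed_compl (fun z hz w hw hzw => ?_) _ _
      (fun z hz => hf z fun h => hz (Metric.ball_subset_closedBall h)) (fun z hz => ?_)
    · have h1 : dist z w ≤ R := hT _ hzw
      have h2 : dist z x ≤ ε := hz
      have h3 : R + 2 * ε ≤ dist w x := by simpa using hw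
      linarith [dist_triangle_right w x z, dist_comm z x, dist_comm w z, dist_triangle w z x]
    · have : φ z = 1 := hφ1 (Metric.ball_subset_closedBall (Set.notMem_compl_iff.1 hz))
      simp [χ, ofCompactSupport_apply, this]
  have h2 : ρ χ * S * ρ g = 0 := by
    refine mul_mul_eq_zero ρ S (isCompact_closedBall x (R + 3 * ε))
      (isCompact_closedBall y ε).isClosed (fun z hz w hw hzw => ?_) _ _
      (fun z hz => ?_) (fun z hz => hg z fun h => hz (Metric.ball_subset_closedBall h))
    · have h1 : dist z w ≤ R' := hS _ hzw
      have h2 : dist z x ≤ R + 3 * ε := hz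
      have h3 : dist w y ≤ ε := hw
      linarith [dist_triangle4 x z w y, dist_comm z x]
    · have : φ z = 0 := hφ0 fun h => hz (Metric.ball_subset_closedBall h)
      simp [χ, ofCompactSupport_apply, this]
  rw [← mul_assoc, h1, mul_assoc, mul_assoc, ← mul_assoc (ρ χ), h2, mul_zero]

end Product

section Algebra

variable {𝕜 : Type*} [RCLike 𝕜] {X : Type*} [MetricSpace X]
  {H : Type*} [NormedAddCommGroup H] [InnerProductSpace 𝕜 H] [CompleteSpace H]
  {ρ : C₀(X, 𝕜) →⋆ₙₐ[𝕜] (H →L[𝕜] H)} {S T : H →L[𝕜] H}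

theorem IsLocallyCompact.zero : IsLocallyCompact ρ (0 : H →L[𝕜] H) := fun f => by
  rw [mul_zero, zero_mul]; exact ⟨isCompactOperator_zero, isCompactOperator_zero⟩

theorem IsLocallyCompact.add (hS : IsLocallyCompact ρ S) (hT : IsLocallyCompact ρ T) :
    IsLocallyCompact ρ (S + T) := fun f => by
  rw [mul_add, add_mul]; exact ⟨(hS f).1.add (hT f).1, (hS f).2.add (hT f).2⟩

theorem IsLocallyCompact.smul (c : 𝕜) (hT : IsLocallyCompact ρ T) :
    IsLocallyCompact ρ (c • T) := fun f => by
  rw [mul_smul_comm, smul_mul_assoc]; exact ⟨(hT f).1.smul c, (hT f).2.smul c⟩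

theorem IsLocallyCompact.mul (hS : IsLocallyCompact ρ S) (hT : IsLocallyCompact ρ T) :
    IsLocallyCompact ρ (S * T) := fun f => by
  rw [← mul_assoc, mul_assoc S]; exact ⟨(hS f).1.comp_clm T, (hT f).2.clm_comp S⟩

theorem IsLocallyCompact.star (hT : IsLocallyCompact ρ T) : IsLocallyCompact ρ (star T) :=
  fun f => by
  have h1 := isCompactOperator_star (hT (Star.star f)).1
  have h2 := isCompactOperator_star (hT (Star.star f)).2
  rw [star_mul, ← map_star, star_star] at h1 h2
  exact ⟨h2, h1⟩

theorem IsControlled.zero : IsControlled ρ (0 : H →L[𝕜] H) :=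
  ⟨1, one_pos, fun p hp => (hp ⟨Set.univ, Set.univ, isOpen_univ, trivial, isOpen_univ, trivial,
    by simp⟩).elim⟩

theorem IsControlled.add (hS : IsControlled ρ S) (hT : IsControlled ρ T) :
    IsControlled ρ (S + T) := by
  obtain ⟨R, hR, hS⟩ := hS
  obtain ⟨R', hR', hT⟩ := hT
  refine ⟨max R R', lt_max_of_lt_left hR, fun p hp => ?_⟩
  by_contra! hd
  obtain ⟨hd, hd'⟩ := max_lt_iff.1 hd
  obtain ⟨U, V, hU, hpU, hV, hpV, h⟩ := Set.notMem_compl_iff.1 fun h => hd.not_ge (hS p h)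
  obtain ⟨U', V', hU', hpU', hV', hpV', h'⟩ := Set.notMem_compl_iff.1 fun h => hd'.not_ge (hT p h)
  refine hp ⟨U ∩ U', V ∩ V', hU.inter hU', ⟨hpU, hpU'⟩, hV.inter hV', ⟨hpV, hpV'⟩,
    fun f g hf hg => ?_⟩
  rw [mul_add, add_mul, h f g (fun z hz => hf z fun h => hz h.1) (fun z hz => hg z fun h => hz h.1),
    h' f g (fun z hz => hf z fun h => hz h.2) (fun z hz => hg z fun h => hz h.2), add_zero]

theorem IsControlled.smul (c : 𝕜) (hT : IsControlled ρ T) : IsControlled ρ (c • T) := by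
  obtain ⟨R, hR, hT⟩ := hT
  refine ⟨R, hR, fun p hp => hT p fun h => hp ?_⟩
  obtain ⟨U, V, hU, hpU, hV, hpV, h⟩ := h
  refine ⟨U, V, hU, hpU, hV, hpV, fun f g hf hg => ?_⟩
  rw [mul_smul_comm, smul_mul_assoc, h f g hf hg, smul_zero]

theorem IsControlled.star (hT : IsControlled ρ T) : IsControlled ρ (star T) := by
  obtain ⟨R, hR, hT⟩ := hT
  refine ⟨R, hR, fun p hp => ?_⟩
  rw [dist_comm]
  refine hT p.swap fun h => hp ?_
  obtain ⟨U, V, hU, hpU, hV, hpV, h⟩ := h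
  refine ⟨V, U, hV, hpV, hU, hpU, fun f g hf hg => ?_⟩
  have := congrArg Star.star (h (Star.star g) (Star.star f) (fun z hz => by simp [hg z hz])
    (fun z hz => by simp [hf z hz]))
  simpa [mul_assoc, ← map_star] using this

end Algebra

section RoeAlgebra

variable {𝕜 : Type*} [RCLike 𝕜] {X : Type*} [MetricSpace X] [ProperSpace X]
  {H : Type*} [NormedAddCommGroup H] [InnerProductSpace 𝕜 H] [CompleteSpace H]

/-- The `*`-algebra of locally compact, controlled operators. -/
noncomputable def algebraicRoe (ρ : C₀(X, 𝕜) →⋆ₙₐ[𝕜] (H →L[𝕜] H)) (hρ : IsNondegenerate ρ) :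
    NonUnitalStarSubalgebra 𝕜 (H →L[𝕜] H) where
  carrier := {T | IsLocallyCompact ρ T ∧ IsControlled ρ T}
  zero_mem' := ⟨.zero, .zero⟩
  add_mem' hS hT := ⟨hS.1.add hT.1, hS.2.add hT.2⟩
  smul_mem' c _ hT := ⟨hT.1.smul c, hT.2.smul c⟩
  mul_mem' hS hT := ⟨hS.1.mul hT.1, hS.2.mul hρ hT.2⟩
  star_mem' hT := ⟨hT.1.star, hT.2.star⟩

/-- The Roe C*-algebra of `X` with respect to the nondegenerate representation `ρ`: the norm
closure in `𝔹(H)` of the `*`-algebra of locally compact, controlled operators. -/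
noncomputable def roe (ρ : C₀(X, 𝕜) →⋆ₙₐ[𝕜] (H →L[𝕜] H)) (hρ : IsNondegenerate ρ) :
    NonUnitalStarSubalgebra 𝕜 (H →L[𝕜] H) :=
  (algebraicRoe ρ hρ).topologicalClosure

end RoeAlgebra

end RoeAlgebra

/-!
Both representations are cut into pieces along one partition of `X` into sets of bounded diameter,
and a unitary that matches the pieces has finite propagation, so conjugation by it identifies the
Roe algebras.

*The cover.* By `exists_open_cover` there is an open cover `U` of `X` by sets of diameter at most
`4`, each of which contains a nonempty open set that no other member meets.

*The pieces.* Well-order the index set. The sets `U s \ ⋃ t < s, U t` partition `X`, and `piece ρ U s`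
plays the role of the range of the spectral projection of such a set. No Borel functional calculus
is needed: the piece is the difference of two subspaces attached to open sets, each the orthogonal
complement of an `annihilator`. The pieces are mutually orthogonal, their sum is dense
(`eq_zero_of_forall_mem_orthogonal_piece`, by well-founded induction), `ρ(f)` vanishes on a piece if
`f` vanishes on `U s` (`rep_apply_eq_zero_of_mem_piece`), and ampleness makes every piece
infinite-dimensional (`not_finiteDimensional_piece`).

*The unitary.* By separability every piece has a Hilbert basis indexed by `ℕ`. Together these form
Hilbert bases of `H₁` and `H₂` with the same index set, and the unitary `e` that matches them
satisfies `ρ₂(f) e ρ₁(g) = 0` as soon as `f` and `g` do not meet a common `U s`; thus it has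
propagation at most `4` (`exists_hasPropagation`).

*Conjugation.* Because of finite propagation, `ρ₂(f) e = ρ₂(f) e ρ₁(χ)` for a compactly supported
`f` and a cut-off `χ` that is `1` near its support. Hence conjugation by `e` preserves local
compactness and controlledness (`IsLocallyCompact.conj`, `IsControlled.conj`) and, by continuity,
maps one Roe algebra into the other; the same holds for `e⁻¹`.
-/

namespace RoeAlgebra

/-! ### Hilbert bases -/

section HilbertSpace

variable {𝕜 : Type*} [RCLike 𝕜] {E : Type*} [NormedAddCommGroup E] [InnerProductSpace 𝕜 E]

/-- Distinct members of an orthonormal family are at distance `√2`, so the balls of radius `1 / 2`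
around them are disjoint. -/
theorem countable_of_orthonormal [TopologicalSpace.SeparableSpace E] {ι : Type*} {v : ι → E}
    (hv : Orthonormal 𝕜 v) : Countable ι := by
  refine Pairwise.countable_of_isOpen_disjoint (s := fun i => Metric.ball (v i) (1 / 2))
    (fun i j hij => Metric.ball_disjoint_ball ?_) (fun _ => Metric.isOpen_ball)
    (fun i => ⟨v i, Metric.mem_ball_self (by norm_num)⟩)
  have h := norm_sub_sq (𝕜 := 𝕜) (v i) (v j)
  rw [hv.2 hij, hv.1 i, hv.1 j, map_zero] at h
  rw [dist_eq_norm]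
  nlinarith [norm_nonneg (v i - v j)]

theorem nonempty_hilbertBasis_nat [CompleteSpace E] [TopologicalSpace.SeparableSpace E]
    (hE : ¬ FiniteDimensional 𝕜 E) : Nonempty (HilbertBasis ℕ 𝕜 E) := by
  obtain ⟨w, b, -⟩ := exists_hilbertBasis 𝕜 E
  have : Countable w := countable_of_orthonormal b.orthonormal
  have : Infinite w := by
    by_contra hw
    have : Finite w := not_infinite_iff_finite.1 hw
    have := Fintype.ofFinite w
    exact hE b.toOrthonormalBasis.toBasis.finiteDimensional_of_finite
  obtain ⟨_⟩ := nonempty_denumerable w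
  let σ := (Denumerable.eqv w).symm
  refine ⟨HilbertBasis.mk (b.orthonormal.comp σ σ.injective) ?_⟩
  rw [σ.surjective.range_comp, b.dense_span]

/-- Hilbert bases of the members of an orthogonal family of subspaces without common orthogonal
vector combine to a Hilbert basis of the whole space. -/
theorem exists_hilbertBasis_sigma [CompleteSpace E] {ι κ : Type*} {F : ι → Submodule 𝕜 E}
    (hF : OrthogonalFamily 𝕜 (fun i => F i) fun i => (F i).subtypeₗᵢ)
    (htot : ∀ v : E, (∀ i, v ∈ (F i)ᗮ) → v = 0) (b : ∀ i, HilbertBasis κ 𝕜 (F i)) :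
    ∃ c : HilbertBasis (Σ _ : ι, κ) 𝕜 E, ∀ i k, c ⟨i, k⟩ = b i k := by
  refine ⟨HilbertBasis.mkOfOrthogonalEqBot
    (hF.orthonormal_sigma_orthonormal fun i => (b i).orthonormal) ?_, fun i k => ?_⟩
  · refine (Submodule.eq_bot_iff _).2 fun v hv => htot v fun i => ?_
    rw [Submodule.mem_orthogonal]
    intro u hu
    let φ : F i →L[𝕜] 𝕜 := innerSL 𝕜 v ∘L (F i).subtypeL
    have hφ : φ = 0 := by
      refine ContinuousLinearMap.ext_on
        (Submodule.dense_iff_topologicalClosure_eq_top.2 (b i).dense_span) ?_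
      rintro _ ⟨k, rfl⟩
      exact (Submodule.mem_orthogonal' _ _).1 hv _ (Submodule.subset_span ⟨⟨i, k⟩, rfl⟩)
    exact inner_eq_zero_symm.1 (DFunLike.congr_fun hφ ⟨u, hu⟩)
  · rw [HilbertBasis.coe_mkOfOrthogonalEqBot]
    rfl

end HilbertSpace

/-! ### A cover by sets of bounded diameter -/

section Cover

/-- The cover consists of balls of radius `2` around the points of a maximal `1`-separated set,
from which the closed balls of radius `1 / 4` around the other points have been removed. -/
theorem exists_open_cover (X : Type*) [MetricSpace X] :
    ∃ (S : Set X) (U : S → Set X), (∀ s, IsOpen (U s)) ∧ ⋃ s, U s = Set.univ ∧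
      (∀ s, ∀ x ∈ U s, ∀ y ∈ U s, dist x y ≤ 4) ∧
      ∀ s, ∃ W ⊆ U s, IsOpen W ∧ W.Nonempty ∧ ∀ t ≠ s, Disjoint W (U t) := by
  obtain ⟨S, hS⟩ := zorn_subset {S : Set X | S.Pairwise fun x y => 1 < dist x y}
    fun c hc hch => ⟨⋃₀ c, (Set.pairwise_sUnion hch.directedOn).2 hc,
      fun s hs => Set.subset_sUnion_of_mem hs⟩
  have hsep (s t : S) (hst : s ≠ t) : 1 < dist (s : X) t :=
    hS.1 s.2 t.2 (Subtype.coe_injective.ne hst)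
  have hlf : LocallyFinite fun t : S => Metric.closedBall (t : X) (1 / 4) := by
    intro x
    refine ⟨Metric.ball x (1 / 4), Metric.ball_mem_nhds x (by norm_num), Set.Subsingleton.finite ?_⟩
    rintro s ⟨y, hy, hy'⟩ t ⟨z, hz, hz'⟩
    by_contra hst
    have := hsep s t hst
    simp only [Metric.mem_closedBall, Metric.mem_ball] at hy hy' hz hz'
    linarith [dist_triangle (s : X) y x, dist_triangle x z t, dist_triangle (s : X) x t,
      dist_comm (s : X) y, dist_comm x z]
  let D (s : S) : Set X := ⋃ t : {t : S // t ≠ s}, Metric.closedBall (t : X) (1 / 4)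
  have hD (s : S) : IsClosed (D s) :=
    (hlf.comp_injective Subtype.coe_injective).isClosed_iUnion fun _ => Metric.isClosed_closedBall
  refine ⟨S, fun s => Metric.ball (s : X) 2 \ D s, fun s => Metric.isOpen_ball.sdiff (hD s),
    Set.eq_univ_of_forall fun x => Set.mem_iUnion.2 ?_, fun s x hx y hy => ?_, fun s =>
    ⟨Metric.ball (s : X) (1 / 4), fun x hx => ⟨Metric.ball_subset_ball (by norm_num) hx, ?_⟩,
      Metric.isOpen_ball, ⟨s, Metric.mem_ball_self (by norm_num)⟩, fun t hts => ?_⟩⟩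
  · by_cases hx : ∃ s : S, dist x s ≤ 1 / 4
    · obtain ⟨s, hs⟩ := hx
      refine ⟨s, Metric.mem_ball.2 (by linarith), fun h => ?_⟩
      obtain ⟨⟨t, hts⟩, ht⟩ := Set.mem_iUnion.1 h
      have ht : dist x t ≤ 1 / 4 := ht
      linarith [hsep t s hts, dist_triangle_left (t : X) s x]
    · push Not at hx
      obtain ⟨s, hs⟩ : ∃ s : S, dist x s ≤ 1 := by
        -- otherwise `x` could be added to the maximal separated set
        by_contra! h
        have hins : (insert x S).Pairwise fun x y => 1 < dist x y :=
          have : Std.Symm fun x y : X => 1 < dist x y := ⟨fun a b hab => by rwa [dist_comm]⟩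
          hS.1.insert_of_symm fun b hb _ => h ⟨b, hb⟩
        have := h ⟨x, hS.2 hins (Set.subset_insert x S) (Set.mem_insert x S)⟩
        norm_num at this
      refine ⟨s, Metric.mem_ball.2 (by linarith), fun h => ?_⟩
      obtain ⟨t, ht⟩ := Set.mem_iUnion.1 h
      exact (hx t).not_ge ht
  · linarith [dist_triangle_right x y s, Metric.mem_ball.1 hx.1, Metric.mem_ball.1 hy.1]
  · intro h
    obtain ⟨⟨t, hts⟩, ht⟩ := Set.mem_iUnion.1 h
    have ht : dist x t ≤ 1 / 4 := ht
    linarith [hsep t s hts, dist_triangle_left (t : X) s x, Metric.mem_ball.1 hx]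
  · exact Set.disjoint_left.2 fun x hx hx' =>
      hx'.2 (Set.mem_iUnion.2 ⟨⟨s, hts.symm⟩, Metric.ball_subset_closedBall hx⟩)

end Cover

/-! ### Functions vanishing off a set -/

section Functions

variable {𝕜 : Type*} [RCLike 𝕜] {X : Type*} [MetricSpace X]

theorem VanishesOff.mono {f : C₀(X, 𝕜)} {V W : Set X} (hf : VanishesOff f V) (h : V ⊆ W) :
    VanishesOff f W := fun x hx => hf x fun h' => hx (h h')

theorem VanishesOff.star {f : C₀(X, 𝕜)} {V : Set X} (hf : VanishesOff f V) :
    VanishesOff (star f) V := fun x hx => by simp [hf x hx]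

theorem VanishesOff.mul_right {f : C₀(X, 𝕜)} {V : Set X} (hf : VanishesOff f V) (g : C₀(X, 𝕜)) :
    VanishesOff (f * g) V := fun x hx => by simp [hf x hx]

theorem exists_eq_one_vanishesOff [ProperSpace X] (𝕜 : Type*) [RCLike 𝕜] {K O : Set X}
    (hK : IsCompact K) (hO : IsOpen O) (hKO : K ⊆ O) :
    ∃ χ : C₀(X, 𝕜), (∀ x ∈ K, χ x = 1) ∧ VanishesOff χ O := by
  obtain ⟨φ, hφ1, hφ0, hφc, -⟩ := exists_continuous_one_zero_of_isCompact hK hO.isClosed_compl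
    (Set.disjoint_compl_right_iff_subset.2 hKO)
  refine ⟨ofCompactSupport 𝕜 φ hφc, fun x hx => ?_, fun x hx => ?_⟩
  · simp [ofCompactSupport_apply, hφ1 hx]
  · simp [ofCompactSupport_apply, hφ0 hx]

/-- Functions that vanish off a compact subset of `V` are dense among those that vanish off `V`:
multiply `f` by a cut-off that is `1` where `‖f‖ ≥ ε` and `0` where `‖f‖ ≤ ε / 2`. -/
theorem mem_of_forall_isCompact [ProperSpace X] (M : Submodule 𝕜 C₀(X, 𝕜))
    (hM : IsClosed (M : Set C₀(X, 𝕜))) {V : Set X}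
    (h : ∀ K ⊆ V, IsCompact K → ∀ f : C₀(X, 𝕜), VanishesOff f K → f ∈ M)
    (f : C₀(X, 𝕜)) (hf : VanishesOff f V) : f ∈ M := by
  have hcomp {δ : ℝ} (hδ : 0 < δ) : IsCompact {x | δ ≤ ‖f x‖} := by
    have hev : ∀ᶠ x in Filter.cocompact X, ‖f x‖ < δ := by
      have := (zero_at_infty f).norm
      rw [norm_zero] at this
      exact this.eventually (gt_mem_nhds hδ)
    obtain ⟨L, hL, hLs⟩ := Filter.mem_cocompact.1 hev
    refine hL.of_isClosed_subset (isClosed_le continuous_const (map_continuous f).norm) fun x hx => ?_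
    by_contra hxL
    have h1 : ‖f x‖ < δ := hLs hxL
    exact h1.not_ge hx
  refine hM.closure_subset (Metric.mem_closure_iff.2 fun ε' hε' => ?_)
  obtain ⟨ε, hε, hεε'⟩ := exists_between hε'
  obtain ⟨φ, hφ1, hφ0, hφc, hφI⟩ := exists_continuous_one_zero_of_isCompact (hcomp hε)
    (isClosed_le (map_continuous f).norm (continuous_const (y := ε / 2)))
    (Set.disjoint_left.2 fun x hx hx' => by
      have h1 : ε ≤ ‖f x‖ := hx
      have h2 : ‖f x‖ ≤ ε / 2 := hx'
      linarith)
  refine ⟨ofCompactSupport 𝕜 φ hφc * f, h {x | ε / 2 ≤ ‖f x‖} (fun x hx => ?_)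
    (hcomp (by positivity)) _ fun x hx => ?_, ?_⟩
  · by_contra hxV
    have hx : ε / 2 ≤ ‖f x‖ := hx
    rw [hf x hxV, norm_zero] at hx
    linarith
  · have : φ x = 0 := hφ0 (show ‖f x‖ ≤ ε / 2 from (not_le.1 hx).le)
    simp [ofCompactSupport_apply, this]
  · rw [← ZeroAtInftyContinuousMap.dist_toBCF_eq_dist]
    refine lt_of_le_of_lt ((BoundedContinuousFunction.dist_le hε.le).2 fun x => ?_) hεε'
    change dist (f x) ((φ x : 𝕜) * f x) ≤ ε
    have h1 : f x - (φ x : 𝕜) * f x = ((1 - φ x : ℝ) : 𝕜) * f x := by push_cast; ring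
    rw [dist_eq_norm, h1, norm_mul, RCLike.norm_ofReal, abs_of_nonneg (sub_nonneg.2 (hφI x).2)]
    by_cases hx : ε ≤ ‖f x‖
    · rw [hφ1 hx]; simpa using hε.le
    · nlinarith [(hφI x).1, (hφI x).2, norm_nonneg (f x)]

end Functions

/-! ### Subspaces attached to open sets -/

section Annihilator

variable {𝕜 : Type*} [RCLike 𝕜] {X : Type*} [MetricSpace X]
  {H : Type*} [NormedAddCommGroup H] [InnerProductSpace 𝕜 H] [CompleteSpace H]

theorem inner_rep_right (ρ : C₀(X, 𝕜) →⋆ₙₐ[𝕜] (H →L[𝕜] H)) (f : C₀(X, 𝕜)) (u v : H) :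
    inner 𝕜 u (ρ f v) = inner 𝕜 (ρ (star f) u) v := by
  rw [map_star, ContinuousLinearMap.star_eq_adjoint, ContinuousLinearMap.adjoint_inner_left]

theorem rep_mul_apply (ρ : C₀(X, 𝕜) →⋆ₙₐ[𝕜] (H →L[𝕜] H)) (f g : C₀(X, 𝕜)) (v : H) :
    ρ (f * g) v = ρ f (ρ g v) := by
  rw [map_mul]; rfl

theorem IsNondegenerate.eq_zero {ρ : C₀(X, 𝕜) →⋆ₙₐ[𝕜] (H →L[𝕜] H)} (hρ : IsNondegenerate ρ)
    {v : H} (hv : ∀ f, ρ f v = 0) : v = 0 := by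
  refine (Submodule.dense_iff_topologicalClosure_eq_top.2 hρ).eq_zero_of_mem_orthogonal
    (𝕜 := 𝕜) ?_
  refine (Submodule.mem_orthogonal' _ _).2 fun u hu => ?_
  induction hu using Submodule.span_induction with
  | mem u hu =>
    obtain ⟨f, w, rfl⟩ := hu
    rw [inner_rep_right, hv, inner_zero_left]
  | zero => exact inner_zero_right _
  | add a b _ _ ha hb => rw [inner_add_right, ha, hb, add_zero]
  | smul c a _ ha => rw [inner_smul_right, ha, mul_zero]

/-- The vectors killed by `ρ(f)` for all `f` that vanish off `V`. For open `V` its orthogonal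
complement is the closure of `ρ(C₀(V)) H`, the range of the spectral projection of `V`. -/
def annihilator (ρ : C₀(X, 𝕜) →⋆ₙₐ[𝕜] (H →L[𝕜] H)) (V : Set X) : Submodule 𝕜 H where
  carrier := {v | ∀ f : C₀(X, 𝕜), VanishesOff f V → ρ f v = 0}
  zero_mem' f _ := map_zero _
  add_mem' ha hb f hf := by rw [map_add, ha f hf, hb f hf, add_zero]
  smul_mem' c a ha f hf := by rw [map_smul, ha f hf, smul_zero]

variable {ρ : C₀(X, 𝕜) →⋆ₙₐ[𝕜] (H →L[𝕜] H)}

theorem isClosed_annihilator (V : Set X) : IsClosed (annihilator ρ V : Set H) := by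
  have : (annihilator ρ V : Set H) =
      ⋂ (f : C₀(X, 𝕜)) (_ : VanishesOff f V), {v | ρ f v = 0} := by
    ext v; simp [annihilator]
  rw [this]
  exact isClosed_iInter fun f => isClosed_iInter fun _ =>
    isClosed_eq (ρ f).continuous continuous_const

instance (V : Set X) : CompleteSpace (annihilator ρ V) :=
  (isClosed_annihilator V).completeSpace_coe

theorem annihilator_anti {V W : Set X} (h : V ⊆ W) : annihilator ρ W ≤ annihilator ρ V :=
  fun _ hv f hf => hv f (hf.mono h)

theorem rep_mem_annihilator (g : C₀(X, 𝕜)) {V : Set X} {v : H} (hv : v ∈ annihilator ρ V) :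
    ρ g v ∈ annihilator ρ V := fun f hf => by
  rw [← rep_mul_apply]; exact hv _ (hf.mul_right g)

theorem rep_mem_annihilator_orthogonal (g : C₀(X, 𝕜)) {V : Set X} {v : H}
    (hv : v ∈ (annihilator ρ V)ᗮ) : ρ g v ∈ (annihilator ρ V)ᗮ := by
  refine (Submodule.mem_orthogonal _ _).2 fun u hu => ?_
  rw [inner_rep_right]
  exact (Submodule.mem_orthogonal _ _).1 hv _ (rep_mem_annihilator _ hu)

theorem rep_apply_mem_annihilator_orthogonal {f : C₀(X, 𝕜)} {V : Set X} (hf : VanishesOff f V)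
    (v : H) : ρ f v ∈ (annihilator ρ V)ᗮ := by
  refine (Submodule.mem_orthogonal _ _).2 fun u hu => ?_
  rw [inner_rep_right, hu _ hf.star, inner_zero_left]

/-- A function that vanishes off the union is, up to approximation and a partition of unity, a sum of
functions that each vanish off one `W i`. -/
theorem mem_annihilator_iUnion [ProperSpace X] {ι : Sort*} {W : ι → Set X}
    (hW : ∀ i, IsOpen (W i)) {v : H} (hv : ∀ i, v ∈ annihilator ρ (W i)) :
    v ∈ annihilator ρ (⋃ i, W i) := by
  let M : Submodule 𝕜 C₀(X, 𝕜) :=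
    { carrier := {f | ρ f v = 0}
      zero_mem' := by simp
      add_mem' := fun {a b} ha hb => by
        simp only [Set.mem_ofPred_eq] at ha hb ⊢
        rw [map_add, add_apply, ha, hb, add_zero]
      smul_mem' := fun c a ha => by
        simp only [Set.mem_ofPred_eq] at ha ⊢
        rw [map_smul, smul_apply, ha, smul_zero] }
  have hM : IsClosed (M : Set C₀(X, 𝕜)) :=
    isClosed_eq ((continuous_rep ρ).clm_apply continuous_const) continuous_const
  refine mem_of_forall_isCompact M hM fun K hKV hK => mem_of_locally_mem M hK fun x hx => ?_
  obtain ⟨i, hi⟩ := Set.mem_iUnion.1 (hKV hx)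
  exact ⟨W i, hW i, hi, hv i⟩

end Annihilator

/-! ### The pieces of a representation along a well-ordered cover -/

section Pieces

variable {𝕜 : Type*} [RCLike 𝕜] {X : Type*} [MetricSpace X]
  {H : Type*} [NormedAddCommGroup H] [InnerProductSpace 𝕜 H] [CompleteSpace H]
  {ι : Type*} [LinearOrder ι]

/-- The part of `H` that lives on `U s \ ⋃ t < s, U t`, that is, the difference of the spectral
projections of the open sets `⋃ t ≤ s, U t` and `⋃ t < s, U t`. -/
def piece (ρ : C₀(X, 𝕜) →⋆ₙₐ[𝕜] (H →L[𝕜] H)) (U : ι → Set X) (s : ι) : Submodule 𝕜 H :=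
  (annihilator ρ (⋃ t : Set.Iic s, U t))ᗮ ⊓ annihilator ρ (⋃ t : Set.Iio s, U t)

variable {ρ : C₀(X, 𝕜) →⋆ₙₐ[𝕜] (H →L[𝕜] H)} {U : ι → Set X}

instance (s : ι) : CompleteSpace (piece ρ U s) :=
  ((Submodule.isClosed_orthogonal _).inter (isClosed_annihilator _)).completeSpace_coe

theorem orthogonalFamily_piece :
    OrthogonalFamily 𝕜 (fun s => piece ρ U s) fun s => (piece ρ U s).subtypeₗᵢ := by
  have key {s t : ι} (hst : s < t) : piece ρ U s ⟂ piece ρ U t := by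
    refine Submodule.isOrtho_iff_le.2 (inf_le_left.trans (Submodule.orthogonal_le ?_))
    refine inf_le_right.trans (annihilator_anti ?_)
    exact Set.iUnion_subset fun r => Set.subset_iUnion_of_subset ⟨r, r.2.trans_lt hst⟩ subset_rfl
  refine OrthogonalFamily.of_pairwise fun s t hst => ?_
  rcases hst.lt_or_gt with h | h
  · exact key h
  · exact (key h).symm

/-- A vector orthogonal to all pieces is killed by `C₀(⋃ t ≤ s, U t)` for every `s`, by
well-founded induction on `s`. -/
theorem eq_zero_of_forall_mem_orthogonal_piece [ProperSpace X] [WellFoundedLT ι]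
    (hρ : IsNondegenerate ρ) (hU : ∀ s, IsOpen (U s)) (hcov : ⋃ s, U s = Set.univ) {v : H}
    (hv : ∀ s, v ∈ (piece ρ U s)ᗮ) : v = 0 := by
  have key (s : ι) : v ∈ annihilator ρ (⋃ t : Set.Iic s, U t) := by
    induction s using WellFoundedLT.induction with
    | ind s ih =>
      have h1 : v ∈ annihilator ρ (⋃ t : Set.Iio s, U t) :=
        mem_annihilator_iUnion (fun t : Set.Iio s => hU t) fun t =>
          annihilator_anti (Set.subset_iUnion_of_subset ⟨t, le_refl (t : ι)⟩ subset_rfl) (ih t t.2)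
      set A := annihilator ρ (⋃ t : Set.Iic s, U t)
      -- the component of `v` orthogonal to `A` lies in the piece of `s`, so it is orthogonal to `v`
      -- and therefore zero
      have hp : A.starProjection v ∈ A := Submodule.starProjection_apply_mem _ _
      have hq : v - A.starProjection v ∈ piece ρ U s := by
        refine ⟨Submodule.sub_starProjection_mem_orthogonal v, sub_mem h1 (annihilator_anti ?_ hp)⟩
        exact Set.iUnion_subset fun r => Set.subset_iUnion_of_subset ⟨r, r.2.le⟩ subset_rfl
      have h2 : inner 𝕜 (v - A.starProjection v) v = 0 :=
        (Submodule.mem_orthogonal _ _).1 (hv s) _ hq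
      have h3 : inner 𝕜 (v - A.starProjection v) (A.starProjection v) = 0 :=
        (Submodule.mem_orthogonal' _ _).1 hq.1 _ hp
      have h4 : v - A.starProjection v = 0 := by
        rw [← inner_self_eq_zero (𝕜 := 𝕜), inner_sub_right, h2, h3, sub_zero]
      rwa [sub_eq_zero.1 h4]
  refine hρ.eq_zero fun f => ?_
  refine mem_annihilator_iUnion (ρ := ρ) hU (fun s => annihilator_anti ?_ (key s)) f fun x hx => ?_
  · exact Set.subset_iUnion_of_subset ⟨s, le_refl s⟩ subset_rfl
  · exact (hx (hcov ▸ Set.mem_univ x)).elim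

theorem rep_apply_eq_zero_of_mem_piece {s : ι} {f : C₀(X, 𝕜)} (hf : ∀ x ∈ U s, f x = 0) {v : H}
    (hv : v ∈ piece ρ U s) : ρ f v = 0 := by
  have h1 : ρ f v ∈ annihilator ρ (⋃ t : Set.Iic s, U t) := fun g hg => by
    rw [← rep_mul_apply]
    refine hv.2 _ fun x hx => ?_
    rw [ZeroAtInftyContinuousMap.mul_apply]
    by_cases hxs : x ∈ U s
    · rw [hf x hxs, mul_zero]
    · rw [hg x, zero_mul]
      intro h
      obtain ⟨⟨t, ht⟩, hxt⟩ := Set.mem_iUnion.1 h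
      rcases (Set.mem_Iic.1 ht).lt_or_eq with h | rfl
      · exact hx (Set.mem_iUnion.2 ⟨⟨t, h⟩, hxt⟩)
      · exact hxs hxt
  exact inner_self_eq_zero.1 ((Submodule.mem_orthogonal _ _).1
    (rep_mem_annihilator_orthogonal f hv.1) _ h1)

/-- A piece contains the range of `ρ(h)` for `h` supported in the part of `U s` that meets no
other member of the cover, and by ampleness this range is infinite-dimensional. -/
theorem not_finiteDimensional_piece [ProperSpace X] (ha : IsAmple ρ) {s : ι} {W : Set X}
    (hWU : W ⊆ U s) (hW : IsOpen W) (hne : W.Nonempty) (hdis : ∀ t ≠ s, Disjoint W (U t)) :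
    ¬ FiniteDimensional 𝕜 (piece ρ U s) := by
  intro hfin
  obtain ⟨x, hx⟩ := hne
  obtain ⟨h, h1, h0⟩ := exists_eq_one_vanishesOff 𝕜 (isCompact_singleton (x := x)) hW
    (Set.singleton_subset_iff.2 hx)
  have hmem (v : H) : ρ h v ∈ piece ρ U s := by
    refine ⟨rep_apply_mem_annihilator_orthogonal (h0.mono ?_) v, fun f hf => ?_⟩
    · exact Set.subset_iUnion_of_subset ⟨s, le_refl s⟩ hWU
    · rw [← rep_mul_apply]
      have : f * h = 0 := by
        ext y
        rw [ZeroAtInftyContinuousMap.mul_apply, ZeroAtInftyContinuousMap.zero_apply]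
        by_cases hy : y ∈ W
        · rw [hf y, zero_mul]
          intro hy'
          obtain ⟨t, ht⟩ := Set.mem_iUnion.1 hy'
          exact Set.disjoint_left.1 (hdis t t.2.ne) hy ht
        · rw [h0 y hy, mul_zero]
      rw [this, map_zero, zero_apply]
  have hcpt : IsCompactOperator (ρ h) := by
    have : ProperSpace (piece ρ U s) := FiniteDimensional.proper_rclike 𝕜 _
    exact (isCompactOperator_of_locallyCompactSpace_rng (piece ρ U s).subtypeL).comp_clm
      ((ρ h).codRestrict (piece ρ U s) hmem)
  have := h1 x rfl
  rw [ha h hcpt] at this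
  exact zero_ne_one this

end Pieces

/-! ### A unitary of finite propagation -/

section Unitary

variable {𝕜 : Type*} [RCLike 𝕜] {X : Type*} [MetricSpace X]
  {H : Type*} [NormedAddCommGroup H] [InnerProductSpace 𝕜 H] [CompleteSpace H]
  {H₁ : Type*} [NormedAddCommGroup H₁] [InnerProductSpace 𝕜 H₁] [CompleteSpace H₁]
  {H₂ : Type*} [NormedAddCommGroup H₂] [InnerProductSpace 𝕜 H₂] [CompleteSpace H₂]

/-- The index `⟨s, k⟩` marks the `k`-th basis vector of the piece of `s`, so that for two
representations the bases have the same index set. -/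
theorem exists_hilbertBasis_adapted [ProperSpace X] [TopologicalSpace.SeparableSpace H]
    {ρ : C₀(X, 𝕜) →⋆ₙₐ[𝕜] (H →L[𝕜] H)} (hρ : IsNondegenerate ρ) (ha : IsAmple ρ)
    {ι : Type*} {U : ι → Set X} (hU : ∀ s, IsOpen (U s)) (hcov : ⋃ s, U s = Set.univ)
    (hW : ∀ s, ∃ W ⊆ U s, IsOpen W ∧ W.Nonempty ∧ ∀ t ≠ s, Disjoint W (U t)) :
    ∃ b : HilbertBasis (Σ _ : ι, ℕ) 𝕜 H,
      ∀ i, ∀ f : C₀(X, 𝕜), (∀ x ∈ U i.1, f x = 0) → ρ f (b i) = 0 := by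
  obtain ⟨_, _⟩ := exists_wellFoundedLT ι
  have hb (s : ι) : Nonempty (HilbertBasis ℕ 𝕜 (piece ρ U s)) := by
    obtain ⟨W, hWU, hWo, hne, hdis⟩ := hW s
    exact nonempty_hilbertBasis_nat (not_finiteDimensional_piece ha hWU hWo hne hdis)
  obtain ⟨c, hc⟩ := exists_hilbertBasis_sigma orthogonalFamily_piece
    (fun v hv => eq_zero_of_forall_mem_orthogonal_piece hρ hU hcov hv) fun s => (hb s).some
  refine ⟨c, fun ⟨s, k⟩ f hf => rep_apply_eq_zero_of_mem_piece hf ?_⟩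
  rw [hc]
  exact Subtype.coe_prop _

/-- A unitary `e : H₁ → H₂` has propagation at most `R` if `ρ₂(f) e ρ₁(g) = 0` whenever the
points where `f` and `g` do not vanish are more than `R` apart. -/
def HasPropagation (ρ₁ : C₀(X, 𝕜) →⋆ₙₐ[𝕜] (H₁ →L[𝕜] H₁)) (ρ₂ : C₀(X, 𝕜) →⋆ₙₐ[𝕜] (H₂ →L[𝕜] H₂))
    (R : ℝ) (e : H₁ ≃ₗᵢ[𝕜] H₂) : Prop :=
  ∀ f g : C₀(X, 𝕜), (∀ x y, f x ≠ 0 → g y ≠ 0 → R < dist x y) → ∀ v, ρ₂ f (e (ρ₁ g v)) = 0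

variable {ρ₁ : C₀(X, 𝕜) →⋆ₙₐ[𝕜] (H₁ →L[𝕜] H₁)} {ρ₂ : C₀(X, 𝕜) →⋆ₙₐ[𝕜] (H₂ →L[𝕜] H₂)}
  {R : ℝ} {e : H₁ ≃ₗᵢ[𝕜] H₂}

theorem exists_hasPropagation [ProperSpace X] [TopologicalSpace.SeparableSpace H₁]
    [TopologicalSpace.SeparableSpace H₂] (hρ₁ : IsNondegenerate ρ₁) (hρ₂ : IsNondegenerate ρ₂)
    (ha₁ : IsAmple ρ₁) (ha₂ : IsAmple ρ₂) : ∃ e : H₁ ≃ₗᵢ[𝕜] H₂, HasPropagation ρ₁ ρ₂ 4 e := by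
  obtain ⟨S, U, hU, hcov, hdiam, hW⟩ := exists_open_cover X
  obtain ⟨b₁, hb₁⟩ := exists_hilbertBasis_adapted hρ₁ ha₁ hU hcov hW
  obtain ⟨b₂, hb₂⟩ := exists_hilbertBasis_adapted hρ₂ ha₂ hU hcov hW
  let e : H₁ ≃ₗᵢ[𝕜] H₂ := b₁.repr.trans b₂.repr.symm
  have hrepr (w : H₁) (i : Σ _ : S, ℕ) : inner 𝕜 (b₂ i) (e w) = inner 𝕜 (b₁ i) w := by
    rw [← b₂.repr_apply_apply, ← b₁.repr_apply_apply]
    simp [e]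
  refine ⟨e, fun f g hfg v => ?_⟩
  refine ext_inner_left 𝕜 fun u => ?_
  rw [inner_zero_right, inner_rep_right]
  refine (b₂.hasSum_inner_mul_inner _ _).unique ?_
  convert! hasSum_zero with i
  rw [hrepr, inner_rep_right, mul_eq_zero]
  -- each term vanishes, as `f` and `g` cannot both be nonzero somewhere on `U i.1`
  by_cases hf : ∀ x ∈ U i.1, f x = 0
  · left
    rw [← inner_rep_right, hb₂ i f hf, inner_zero_right]
  · right
    push Not at hf
    obtain ⟨x, hx, hfx⟩ := hf
    rw [hb₁ i (star g), inner_zero_left]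
    intro y hy
    by_contra hgy
    refine (hfg x y hfx fun h => hgy ?_).not_ge (hdiam i.1 x hx y hy)
    simp [h]

theorem HasPropagation.symm (he : HasPropagation ρ₁ ρ₂ R e) : HasPropagation ρ₂ ρ₁ R e.symm := by
  intro f g hfg v
  refine ext_inner_left 𝕜 fun u => ?_
  rw [inner_zero_right, inner_rep_right, ← e.inner_map_map, e.apply_symm_apply, inner_rep_right,
    he, inner_zero_left]
  intro x y hx hy
  rw [dist_comm]
  exact hfg y x (fun h => hy (by simp [h])) fun h => hx (by simp [h])

theorem HasPropagation.rep_apply (he : HasPropagation ρ₁ ρ₂ R e) (hρ₁ : IsNondegenerate ρ₁)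
    {f χ : C₀(X, 𝕜)} (hχ : ∀ x y, f x ≠ 0 → dist x y ≤ R → χ y = 1) (v : H₁) :
    ρ₂ f (e (ρ₁ χ v)) = ρ₂ f (e v) := by
  let A : H₁ →L[𝕜] H₂ := ρ₂ f ∘L (e : H₁ →L[𝕜] H₂)
  have hA : A ∘L ρ₁ χ = A := by
    refine ContinuousLinearMap.ext_on (Submodule.dense_iff_topologicalClosure_eq_top.2 hρ₁) ?_
    rintro _ ⟨h, w, rfl⟩
    have := he f (χ * h - h) (fun x y hx hy => ?_) w
    · rw [map_sub, sub_apply, rep_mul_apply, map_sub, map_sub, sub_eq_zero] at this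
      exact this
    · by_contra! hxy
      exact hy (by simp [hχ x y hx hxy])
  exact DFunLike.congr_fun hA v

theorem HasPropagation.rep_symm_apply (he : HasPropagation ρ₁ ρ₂ R e) (hρ₁ : IsNondegenerate ρ₁)
    {f χ : C₀(X, 𝕜)} (hχ : ∀ x y, f x ≠ 0 → dist x y ≤ R → χ y = 1) (v : H₂) :
    ρ₁ χ (e.symm (ρ₂ f v)) = e.symm (ρ₂ f v) := by
  refine sub_eq_zero.1 (hρ₁.eq_zero fun h => ?_)
  have := he.symm (h * χ - h) f (fun x y hx hy => ?_) v
  · rwa [map_sub, sub_apply, rep_mul_apply, ← map_sub] at this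
  · by_contra! hxy
    rw [dist_comm] at hxy
    exact hx (by simp [hχ y x hy hxy])

end Unitary

/-! ### Conjugation by a unitary of finite propagation -/

section Conjugation

variable {𝕜 : Type*} [RCLike 𝕜] {X : Type*} [MetricSpace X] [ProperSpace X]
  {H₁ : Type*} [NormedAddCommGroup H₁] [InnerProductSpace 𝕜 H₁] [CompleteSpace H₁]
  {H₂ : Type*} [NormedAddCommGroup H₂] [InnerProductSpace 𝕜 H₂] [CompleteSpace H₂]
  {ρ₁ : C₀(X, 𝕜) →⋆ₙₐ[𝕜] (H₁ →L[𝕜] H₁)} {ρ₂ : C₀(X, 𝕜) →⋆ₙₐ[𝕜] (H₂ →L[𝕜] H₂)}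
  {R : ℝ} {e : H₁ ≃ₗᵢ[𝕜] H₂} {T : H₁ →L[𝕜] H₁}

/-- For compactly supported `f`, a cut-off `χ` that is `1` on the closed `R`-neighbourhood of the
support of `f` gives `ρ₂(f) e T e⁻¹ = ρ₂(f) e (ρ₁(χ) T) e⁻¹`. -/
theorem IsLocallyCompact.conj_left (hT : IsLocallyCompact ρ₁ T) (he : HasPropagation ρ₁ ρ₂ R e)
    (hρ₁ : IsNondegenerate ρ₁) (f : C₀(X, 𝕜)) :
    IsCompactOperator (ρ₂ f * e.conjStarAlgEquiv T) := by
  let M : Submodule 𝕜 C₀(X, 𝕜) :=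
    { carrier := {f | IsCompactOperator (ρ₂ f * e.conjStarAlgEquiv T)}
      zero_mem' := by
        simp only [Set.mem_ofPred_eq, map_zero, zero_mul]
        exact isCompactOperator_zero
      add_mem' := fun {a b} ha hb => by
        simp only [Set.mem_ofPred_eq, map_add, add_mul] at ha hb ⊢
        exact ha.add hb
      smul_mem' := fun c a ha => by
        simp only [Set.mem_ofPred_eq, map_smul, smul_mul_assoc] at ha ⊢
        exact ha.smul c }
  have hM : IsClosed (M : Set C₀(X, 𝕜)) :=
    (isClosed_setOfPred_isCompactOperator (M₁ := H₂) (M₂ := H₂) (σ₁₂ := RingHom.id 𝕜)).preimage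
      ((continuous_rep ρ₂).mul continuous_const)
  refine mem_of_forall_isCompact M hM (V := Set.univ) (fun K _ hK f hf => ?_) f
    fun x hx => (hx trivial).elim
  obtain ⟨χ, hχ, -⟩ := exists_eq_one_vanishesOff 𝕜 (hK.cthickening (r := R)) isOpen_univ
    (Set.subset_univ _)
  have hχf (x y : X) (hx : f x ≠ 0) (hxy : dist x y ≤ R) : χ y = 1 := by
    refine hχ y (Metric.mem_cthickening_of_dist_le y x R K ?_ (by rwa [dist_comm]))
    by_contra hxK
    exact hx (hf x hxK)
  have hc : IsCompactOperator
      ((ρ₂ f ∘L (e : H₁ →L[𝕜] H₂)) ∘L (ρ₁ χ * T) ∘L (e.symm : H₂ →L[𝕜] H₁)) :=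
    ((hT χ).1.comp_clm (e.symm : H₂ →L[𝕜] H₁)).clm_comp (ρ₂ f ∘L (e : H₁ →L[𝕜] H₂))
  have heq : ρ₂ f * e.conjStarAlgEquiv T =
      (ρ₂ f ∘L (e : H₁ →L[𝕜] H₂)) ∘L (ρ₁ χ * T) ∘L (e.symm : H₂ →L[𝕜] H₁) := by
    ext v
    exact (he.rep_apply hρ₁ hχf (T (e.symm v))).symm
  change IsCompactOperator (ρ₂ f * e.conjStarAlgEquiv T)
  rwa [heq]

theorem IsLocallyCompact.conj (hT : IsLocallyCompact ρ₁ T) (he : HasPropagation ρ₁ ρ₂ R e)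
    (hρ₁ : IsNondegenerate ρ₁) : IsLocallyCompact ρ₂ (e.conjStarAlgEquiv T) := fun f => by
  refine ⟨hT.conj_left he hρ₁ f, ?_⟩
  have := isCompactOperator_star (hT.star.conj_left he hρ₁ (Star.star f))
  rwa [star_mul, ← map_star, ← map_star, star_star, star_star] at this

theorem IsControlled.conj (hT : IsControlled ρ₁ T) (hR : 0 ≤ R) (he : HasPropagation ρ₁ ρ₂ R e)
    (hρ₁ : IsNondegenerate ρ₁) : IsControlled ρ₂ (e.conjStarAlgEquiv T) := by
  obtain ⟨R', hR', hT⟩ := hT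
  refine ⟨R' + 2 * R, by positivity, fun ⟨x, y⟩ hp => ?_⟩
  by_contra! hd
  refine hp ?_
  obtain ⟨ε, hε, hd⟩ : ∃ ε : ℝ, 0 < ε ∧ R' + 2 * R + 5 * ε = dist x y :=
    ⟨(dist x y - R' - 2 * R) / 5, by simp only at hd; linarith, by ring⟩
  refine ⟨Metric.ball x ε, Metric.ball y ε, Metric.isOpen_ball, Metric.mem_ball_self hε,
    Metric.isOpen_ball, Metric.mem_ball_self hε, fun f g hf hg => ?_⟩
  have hcut (z : X) : ∃ χ : C₀(X, 𝕜), (∀ w ∈ Metric.closedBall z (R + ε), χ w = 1) ∧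
      VanishesOff χ (Metric.ball z (R + 2 * ε)) :=
    exists_eq_one_vanishesOff 𝕜 (isCompact_closedBall z (R + ε)) Metric.isOpen_ball
      (Metric.closedBall_subset_ball (by linarith))
  have hcut' {z : X} {h χ : C₀(X, 𝕜)} (hh : VanishesOff h (Metric.ball z ε))
      (hχ : ∀ w ∈ Metric.closedBall z (R + ε), χ w = 1) (a b : X) (ha : h a ≠ 0)
      (hab : dist a b ≤ R) : χ b = 1 := by
    have haz : dist a z < ε := by
      by_contra haz
      exact ha (hh a haz)
    exact hχ b (Metric.mem_closedBall.2 (by linarith [dist_triangle_left b z a]))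
  obtain ⟨χ, hχ1, hχ0⟩ := hcut x
  obtain ⟨ψ, hψ1, hψ0⟩ := hcut y
  have h0 : ρ₁ χ * T * ρ₁ ψ = 0 := by
    refine mul_mul_eq_zero_of_isCompact ρ₁ T (isCompact_closedBall x (R + 2 * ε))
      (isCompact_closedBall y (R + 2 * ε)) (fun z hz w hw hzw => ?_) χ ψ
      (hχ0.mono Metric.ball_subset_closedBall) (hψ0.mono Metric.ball_subset_closedBall)
    have h1 : dist z w ≤ R' := hT _ hzw
    have h2 : dist z x ≤ R + 2 * ε := hz
    have h3 : dist w y ≤ R + 2 * ε := hw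
    linarith [dist_triangle4 x z w y, dist_comm z x]
  ext v
  change ρ₂ f (e (T (e.symm (ρ₂ g v)))) = 0
  rw [← he.rep_apply hρ₁ (hcut' hf hχ1), ← he.rep_symm_apply hρ₁ (hcut' hg hψ1)]
  have : ρ₁ χ (T (ρ₁ ψ (e.symm (ρ₂ g v)))) = 0 := DFunLike.congr_fun h0 _
  rw [this, map_zero, map_zero]

theorem conj_mem_roe (hR : 0 ≤ R) (he : HasPropagation ρ₁ ρ₂ R e) (hρ₁ : IsNondegenerate ρ₁)
    (hρ₂ : IsNondegenerate ρ₂) (hT : T ∈ roe ρ₁ hρ₁) : e.conjStarAlgEquiv T ∈ roe ρ₂ hρ₂ := by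
  have hc : Continuous e.conjStarAlgEquiv :=
    e.toContinuousLinearEquiv.conjContinuousAlgEquiv.continuous
  exact map_mem_closure hc hT fun S hS => ⟨hS.1.conj he hρ₁, hS.2.conj hR he hρ₁⟩

end Conjugation

end RoeAlgebra

theorem mainTheorem6 {𝕜 : Type*} [RCLike 𝕜] {X : Type*} [MetricSpace X] [ProperSpace X]
    {H₁ : Type*} [NormedAddCommGroup H₁] [InnerProductSpace 𝕜 H₁] [CompleteSpace H₁]
    [TopologicalSpace.SeparableSpace H₁]
    {H₂ : Type*} [NormedAddCommGroup H₂] [InnerProductSpace 𝕜 H₂] [CompleteSpace H₂]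
    [TopologicalSpace.SeparableSpace H₂]
    (ρ₁ : C₀(X, 𝕜) →⋆ₙₐ[𝕜] (H₁ →L[𝕜] H₁)) (ρ₂ : C₀(X, 𝕜) →⋆ₙₐ[𝕜] (H₂ →L[𝕜] H₂))
    (hρ₁ : RoeAlgebra.IsNondegenerate ρ₁) (hρ₂ : RoeAlgebra.IsNondegenerate ρ₂)
    (ha₁ : RoeAlgebra.IsAmple ρ₁) (ha₂ : RoeAlgebra.IsAmple ρ₂) :
    Nonempty (RoeAlgebra.roe ρ₁ hρ₁ ≃⋆ₐ[𝕜] RoeAlgebra.roe ρ₂ hρ₂) ∧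
    ∃ U : H₁ →L[𝕜] H₂,
      ContinuousLinearMap.adjoint U ∘L U = ContinuousLinearMap.id 𝕜 H₁ ∧
      U ∘L ContinuousLinearMap.adjoint U = ContinuousLinearMap.id 𝕜 H₂ ∧
      (fun T : H₁ →L[𝕜] H₁ => U ∘L T ∘L ContinuousLinearMap.adjoint U) ''
        (RoeAlgebra.roe ρ₁ hρ₁ : Set (H₁ →L[𝕜] H₁)) =
        (RoeAlgebra.roe ρ₂ hρ₂ : Set (H₂ →L[𝕜] H₂)) := by
  obtain ⟨e, he⟩ := RoeAlgebra.exists_hasPropagation hρ₁ hρ₂ ha₁ ha₂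
  have h₁₂ (T) (hT : T ∈ RoeAlgebra.roe ρ₁ hρ₁) : e.conjStarAlgEquiv T ∈ RoeAlgebra.roe ρ₂ hρ₂ :=
    RoeAlgebra.conj_mem_roe (by norm_num) he hρ₁ hρ₂ hT
  have h₂₁ (T) (hT : T ∈ RoeAlgebra.roe ρ₂ hρ₂) :
      e.conjStarAlgEquiv.symm T ∈ RoeAlgebra.roe ρ₁ hρ₁ :=
    RoeAlgebra.conj_mem_roe (by norm_num) he.symm hρ₂ hρ₁ hT
  refine ⟨⟨{
    toFun := fun T => ⟨e.conjStarAlgEquiv T, h₁₂ T T.2⟩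
    invFun := fun T => ⟨e.conjStarAlgEquiv.symm T, h₂₁ T T.2⟩
    left_inv := fun T => Subtype.ext (e.conjStarAlgEquiv.symm_apply_apply T)
    right_inv := fun T => Subtype.ext (e.conjStarAlgEquiv.apply_symm_apply T)
    map_mul' := fun S T => Subtype.ext (map_mul e.conjStarAlgEquiv (S : H₁ →L[𝕜] H₁) T)
    map_add' := fun S T => Subtype.ext (map_add e.conjStarAlgEquiv (S : H₁ →L[𝕜] H₁) T)
    map_star' := fun T => Subtype.ext (map_star e.conjStarAlgEquiv (T : H₁ →L[𝕜] H₁))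
    map_smul' := fun c T => Subtype.ext (map_smul e.conjStarAlgEquiv c (T : H₁ →L[𝕜] H₁)) }⟩,
    (e : H₁ →L[𝕜] H₂), ?_⟩
  rw [e.adjoint_eq_symm]
  refine ⟨by ext v; simp, by ext v; simp, ?_⟩
  refine Set.Subset.antisymm ?_ fun T hT => ⟨_, h₂₁ T hT, e.conjStarAlgEquiv.apply_symm_apply T⟩
  rintro _ ⟨T, hT, rfl⟩
  exact h₁₂ T hT
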